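/- Let $a<b$ be reals and let $f:[a,b]\to\mathbb{R}$ be continuous with $0<\inf_{[a,b]}f\le\sup_{[a,b]}f<\infty$. Put $F(t)=\int_a^t f(x)\,dx$ for $t\in[a,b]$. For each $n$, let $F_n$ be a real-valued process on $[a,b]$ with (almost surely) cadlag paths. Let $L:[a,b]\to\mathbb{R}$ be non-decreasing and bounded, and for each $n$ let $B_n$ be a process on $[L(a),L(b)]$, defined on the same probability space as $F_n$, which is either a standard Brownian motion (the restriction to $[L(a),L(b)]$ of a two-sided Brownian motion on $\mathbb{R}$ vanishing at $0$, with continuous paths) or a standard Brownian bridge (the restriction to $[L(a),L(b)]\subseteq[0,1]$ of a Brownian bridge on $[0,1]$, with continuous paths). Assume that $$\sup_{t\in[a,b]}\bigl|F_n(t)-F(t)-n^{-1/2}B_n(L(t))\bigr|=O_p(\gamma_n)$$ for some real sequence $\gamma_n=O(n^{-1}\log n)$. Define $$H_n(t)=\int_a^t\bigl(F_n(b)-F_n(x)\bigr)\,dx,\qquad t\in[a,b],$$ and let $\hat H_n$ be the least concave majorant of $H_n$ on $[a,b]$. Then $$\sup_{x\in[a,b]}\bigl|\hat H_n(x)-H_n(x)\bigr|=O_p\left(\frac{\log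 n}{n}\right).$$ Here $X_n=O_p(r_n)$ means that for every $\varepsilon>0$ there is a constant $C>0$ such that $\mathbb{P}(X_n>C|r_n|)\le\varepsilon$ for all sufficiently large $n$. -/

import Mathlib

open MeasureTheory ProbabilityTheory Set Filter Topology
open scoped ENNReal

/-- `B`, restricted to the time set `I`, is a standard Brownian motion on `I`, i.e. the restriction
to `I` of a two-sided Brownian motion `(B t)_{t ∈ ℝ}` with `B 0 = 0`: a centred Gaussian process
with covariance `(|s| + |t| - |s - t|) / 2` (equal to `min s t` for `s, t ≥ 0`) and almost surely
continuous paths. Nothing is required of `B` outside `I`. -/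
structure IsBrownianMotionOn {Ω : Type*} [MeasurableSpace Ω] (P : Measure Ω) (I : Set ℝ)
    (B : ℝ → Ω → ℝ) : Prop where
  gaussian : IsGaussianProcess (fun (t : I) ↦ B t) P
  mean : ∀ t ∈ I, ∫ ω, B t ω ∂P = 0
  covariance : ∀ s ∈ I, ∀ t ∈ I, cov[B s, B t; P] = (|s| + |t| - |s - t|) / 2
  continuous : ∀ᵐ ω ∂P, ContinuousOn (fun t ↦ B t ω) I

/-- `B`, restricted to the time set `I ⊆ [0, 1]`, is a standard Brownian bridge on `I`, i.e. the
restriction to `I` of a Brownian bridge on `[0, 1]`: a centred Gaussian process with covariance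
`min s t - s * t` and almost surely continuous paths. -/
structure IsBrownianBridgeOn {Ω : Type*} [MeasurableSpace Ω] (P : Measure Ω) (I : Set ℝ)
    (B : ℝ → Ω → ℝ) : Prop where
  subset : I ⊆ Icc 0 1
  gaussian : IsGaussianProcess (fun (t : I) ↦ B t) P
  mean : ∀ t ∈ I, ∫ ω, B t ω ∂P = 0
  covariance : ∀ s ∈ I, ∀ t ∈ I, cov[B s, B t; P] = min s t - s * t
  continuous : ∀ᵐ ω ∂P, ContinuousOn (fun t ↦ B t ω) I

/-- `g` is cadlag on `[a, b]`: right-continuous on `[a, b)` with left limits on `(a, b]`. -/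
def IsCadlagOn (a b : ℝ) (g : ℝ → ℝ) : Prop :=
  (∀ t ∈ Ico a b, ContinuousWithinAt g (Ioi t) t) ∧
    ∀ t ∈ Ioc a b, ∃ l : ℝ, Tendsto g (𝓝[<] t) (𝓝 l)

/-- The least concave majorant on `s` of `g`: the pointwise infimum of all functions that are
concave on `s` and lie above `g` on `s`. -/
noncomputable def leastConcaveMajorant (s : Set ℝ) (g : ℝ → ℝ) (x : ℝ) : ℝ :=
  sInf {y : ℝ | ∃ h : ℝ → ℝ, ConcaveOn ℝ s h ∧ (∀ z ∈ s, g z ≤ h z) ∧ h x = y}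

/-- The supremum `sup_{t ∈ s} |g t|`, as an extended nonnegative number. -/
noncomputable def supNormOn (s : Set ℝ) (g : ℝ → ℝ) : ℝ≥0∞ :=
  ⨆ t ∈ s, ENNReal.ofReal |g t|

/-- `X n = O_p(r n)`: for every `ε > 0` there is a constant `C` such that
`P n (X n > C * |r n|) ≤ ε` for all large `n`. The probability space may vary with `n`. -/
def IsBigOInProbability {Ω : ℕ → Type*} [∀ n, MeasurableSpace (Ω n)] (P : ∀ n, Measure (Ω n))
    (X : ∀ n, Ω n → ℝ≥0∞) (r : ℕ → ℝ) : Prop :=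
  ∀ ε : ℝ, 0 < ε → ∃ C : ℝ, 0 < C ∧
    ∀ᶠ n in atTop, P n {ω | ENNReal.ofReal (C * |r n|) < X n ω} ≤ ENNReal.ofReal ε

/-!
Up to an error `O_p(log n / n)`, the derivative `F_n(b) - F_n(x)` of `H_n` is
`F_n(b) - F(x) - n^{-1/2} B_n(L x)`. Since `f ≥ m > 0`, the primitive of `-F` is strongly concave:
it falls at least `m d² / 2` below its tangent at distance `d` from the point of tangency. The
Brownian term can raise `H_n` above that tangent by at most `n^{-1/2} K d`, where
`K = sup |B_n|`. The net gain `n^{-1/2} K d - m d² / 2` is at most `K² / (2 m n)` whatever `d` is,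
so that a tangent raised by `K² / (2 m n)` plus the integrated approximation error is a concave
majorant of `H_n` (`integral_le_affine`, `abs_leastConcaveMajorant_sub_le`). Only the size of `B_n`
enters, not its modulus of continuity, which is why `L` may be any monotone function.

It remains to see that `sup |B_n|` is bounded in probability, uniformly in `n`. The law of a
Gaussian process on a countable dense set is determined by its mean and covariance, so all the Brownian
motions among the `B_n` have suprema with the same law, and so do all the bridges; each supremum is
almost surely finite by continuity of the paths (`exists_uniform_bound_of_gaussian`).
-/

/-! ### Gaussian processes with equal covariances -/

/-- A finite Gaussian family is determined in law by its means and covariances, also when the two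
families live on different probability spaces. -/
theorem ProbabilityTheory.HasGaussianLaw.map_pi_eq {ι Ω Ω' : Type*} [Finite ι] [MeasurableSpace Ω]
    [MeasurableSpace Ω'] {P : Measure Ω} {P' : Measure Ω'} {X : ι → Ω → ℝ} {Y : ι → Ω' → ℝ}
    (hX : HasGaussianLaw (fun ω i ↦ X i ω) P) (hY : HasGaussianLaw (fun ω i ↦ Y i ω) P')
    (hmean : ∀ i, ∫ ω, X i ω ∂P = ∫ ω, Y i ω ∂P')
    (hcov : ∀ i j, cov[X i, X j; P] = cov[Y i, Y j; P']) :
    P.map (fun ω i ↦ X i ω) = P'.map (fun ω i ↦ Y i ω) := by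
  classical
  have := Fintype.ofFinite ι
  have := hX.isProbabilityMeasure
  have := hY.isProbabilityMeasure
  have hXm i : MemLp (X i) 2 P := (hX.eval i).memLp_two
  have hYm i : MemLp (Y i) 2 P' := (hY.eval i).memLp_two
  have := hX.isGaussian_map
  have := hY.isGaussian_map
  apply Measure.ext_of_charFunDual
  ext ℓ
  obtain ⟨c, hc⟩ : ∃ c : ι → ℝ, ∀ x : ι → ℝ, ℓ x = ∑ i, c i * x i := by
    refine ⟨fun i ↦ ℓ (fun j ↦ if i = j then 1 else 0), fun x ↦ ?_⟩
    rw [← ContinuousLinearMap.coe_coe, LinearMap.pi_apply_eq_sum_univ ℓ.toLinearMap x]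
    exact Finset.sum_congr rfl fun i _ ↦ by simp [mul_comm]
  have hXc i : MemLp (fun ω ↦ c i * X i ω) 2 P := (hXm i).const_mul _
  have hYc i : MemLp (fun ω ↦ c i * Y i ω) 2 P' := (hYm i).const_mul _
  have hm : ∫ ω, ℓ (fun i ↦ X i ω) ∂P = ∫ ω, ℓ (fun i ↦ Y i ω) ∂P' := by
    simp only [hc]
    rw [integral_finsetSum _ fun i _ ↦ (hXc i).integrable one_le_two,
      integral_finsetSum _ fun i _ ↦ (hYc i).integrable one_le_two]
    simp only [integral_const_mul, hmean]
  have hv : Var[fun ω ↦ ℓ (fun i ↦ X i ω); P] = Var[fun ω ↦ ℓ (fun i ↦ Y i ω); P'] := by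
    simp only [hc]
    rw [← covariance_self (Finset.aemeasurable_fun_sum _ fun i _ ↦ (hXc i).aemeasurable),
      ← covariance_self, covariance_fun_sum_fun_sum hXc hXc, covariance_fun_sum_fun_sum hYc hYc]
    · simp only [covariance_const_mul_left, covariance_const_mul_right]
      congr! 6 with i _ j _
      exact hcov i j
    · exact Finset.aemeasurable_fun_sum _ fun i _ ↦ (hYc i).aemeasurable
  rw [hX.charFunDual_map_eq_fun, hY.charFunDual_map_eq_fun, hm, hv]

/-- A Gaussian process indexed by a countable set is determined in law by its mean and covariance
functions. -/
theorem ProbabilityTheory.IsGaussianProcess.map_eq {T Ω Ω' : Type*} [Countable T]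
    [MeasurableSpace Ω] [MeasurableSpace Ω'] {P : Measure Ω} {P' : Measure Ω'} {X : T → Ω → ℝ} {Y : T → Ω' → ℝ}
    (hX : IsGaussianProcess X P) (hY : IsGaussianProcess Y P')
    (hmean : ∀ t, ∫ ω, X t ω ∂P = ∫ ω, Y t ω ∂P')
    (hcov : ∀ s t, cov[X s, X t; P] = cov[Y s, Y t; P']) :
    P.map (fun ω t ↦ X t ω) = P'.map (fun ω t ↦ Y t ω) := by
  have := hX.isProbabilityMeasure
  have := hY.isProbabilityMeasure
  have hX' : AEMeasurable (fun ω t ↦ X t ω) P := aemeasurable_pi_lambda _ hX.aemeasurable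
  have hY' : AEMeasurable (fun ω t ↦ Y t ω) P' := aemeasurable_pi_lambda _ hY.aemeasurable
  have hlim := isProjectiveLimit_map hY'
  have hfin (I : Finset T) : P.map (fun ω ↦ I.restrict (X · ω))
      = P'.map (fun ω ↦ I.restrict (Y · ω)) :=
    HasGaussianLaw.map_pi_eq (X := fun (i : I) ↦ X i) (Y := fun (i : I) ↦ Y i)
      (hX.hasGaussianLaw I) (hY.hasGaussianLaw I) (fun i ↦ hmean i) (fun i j ↦ hcov i j)
  have hlim' := isProjectiveLimit_map hX'
  have (I : Finset T) : IsFiniteMeasure (P'.map (fun ω ↦ I.restrict (Y · ω))) :=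
    inferInstance
  simp_rw [hfin] at hlim'
  exact hlim'.unique hlim

/-- Continuous Gaussian processes on a compact set that share their mean and covariance functions
have suprema that are tight, uniformly over the family: on a countable dense subset they all have
the same law, so a bound that works for one of them works for all. -/
theorem exists_uniform_bound_of_gaussian {ι : Type*} {Ω : ι → Type*} [∀ i, MeasurableSpace (Ω i)]
    {P : ∀ i, Measure (Ω i)} {S : Set ℝ} (hS : IsCompact S) {B : ∀ i, ℝ → Ω i → ℝ}
    {m : ℝ → ℝ} {K : ℝ → ℝ → ℝ}
    (hgauss : ∀ i, IsGaussianProcess (fun t : S ↦ B i t) (P i))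
    (hmean : ∀ i, ∀ t ∈ S, ∫ ω, B i t ω ∂(P i) = m t)
    (hcov : ∀ i, ∀ s ∈ S, ∀ t ∈ S, cov[B i s, B i t; P i] = K s t)
    (hcont : ∀ i, ∀ᵐ ω ∂(P i), ContinuousOn (fun t ↦ B i t ω) S)
    {ε : ℝ≥0∞} (hε : 0 < ε) :
    ∃ k : ℕ, ∀ i, P i {ω | ¬ ∀ t ∈ S, |B i t ω| ≤ k} ≤ ε := by
  rcases isEmpty_or_nonempty ι with hι | ⟨⟨i₀⟩⟩
  · exact ⟨0, fun i ↦ hι.elim i⟩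
  obtain ⟨D, hDc, hD⟩ := TopologicalSpace.exists_countable_dense S
  have : Countable D := hDc.to_subtype
  let X (i : ι) (t : D) : Ω i → ℝ := B i (t : S)
  have hX i : IsGaussianProcess (X i) (P i) := (hgauss i).restrict D
  have hXm i : AEMeasurable (fun ω t ↦ X i t ω) (P i) :=
    aemeasurable_pi_lambda _ (hX i).aemeasurable
  have := (hX i₀).isProbabilityMeasure
  let A (k : ℕ) : Set (D → ℝ) := {x | ¬ ∀ t, |x t| ≤ k}
  have hA k : MeasurableSet (A k) := by
    refine MeasurableSet.compl (s := {x : D → ℝ | ∀ t, |x t| ≤ k}) ?_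
    rw [ofPred_forall]
    exact MeasurableSet.iInter fun t ↦ measurableSet_le (by fun_prop) measurable_const
  have hlaw i : (P i).map (fun ω t ↦ X i t ω) = (P i₀).map (fun ω t ↦ X i₀ t ω) := by
    refine IsGaussianProcess.map_eq (hX i) (hX i₀) (fun t ↦ ?_) (fun s t ↦ ?_)
    · rw [hmean i _ (t : S).2, hmean i₀ _ (t : S).2]
    · rw [hcov i _ (s : S).2 _ (t : S).2, hcov i₀ _ (s : S).2 _ (t : S).2]
  have hlim : Tendsto (fun k ↦ (P i₀).map (fun ω t ↦ X i₀ t ω) (A k)) atTop (𝓝 0) := by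
    have hnull : (P i₀).map (fun ω t ↦ X i₀ t ω) (⋂ k, A k) = 0 := by
      rw [Measure.map_apply_of_aemeasurable (hXm i₀) (MeasurableSet.iInter hA)]
      refine measure_mono_null (fun ω hω ↦ ?_) (hcont i₀)
      intro hc
      obtain ⟨C, hC⟩ := hS.exists_bound_of_continuousOn hc
      obtain ⟨k, hk⟩ := exists_nat_ge C
      exact mem_iInter.1 hω k fun t ↦ (hC _ (t : S).2).trans hk
    rw [← hnull]
    refine tendsto_measure_iInter_atTop (fun k ↦ (hA k).nullMeasurableSet)
      (fun k l hkl x hx h ↦ hx fun t ↦ (h t).trans (by exact_mod_cast hkl))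
      ⟨0, measure_ne_top _ _⟩
  obtain ⟨k, hk⟩ := ((tendsto_order.1 hlim).2 ε hε).exists
  refine ⟨k, fun i ↦ ?_⟩
  rw [← hlaw i, Measure.map_apply_of_aemeasurable (hXm i) (hA k)] at hk
  refine (measure_mono_ae ?_).trans hk.le
  filter_upwards [hcont i] with ω hω hnot hle
  refine hnot fun t ht ↦ ?_
  have hcl : IsClosed {s : S | |B i s ω| ≤ k} :=
    isClosed_le (continuousOn_iff_continuous_domRestrict.1 hω).abs continuous_const
  exact closure_minimal (fun s hs ↦ hle ⟨s, hs⟩) hcl (hD ⟨t, ht⟩)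

/-- The type of the process may change with `n`, so the bound is the larger of the one for the
indices with a Brownian motion and the one for those with a Brownian bridge. -/
theorem exists_uniform_bound_of_brownian {Ω : ℕ → Type*} [∀ n, MeasurableSpace (Ω n)]
    {P : ∀ n, Measure (Ω n)} {u v : ℝ} {B : ∀ n, ℝ → Ω n → ℝ}
    (hB : ∀ n, IsBrownianMotionOn (P n) (Icc u v) (B n) ∨ IsBrownianBridgeOn (P n) (Icc u v) (B n))
    {ε : ℝ≥0∞} (hε : 0 < ε) :
    ∃ k : ℕ, ∀ n, P n {ω | ¬ ∀ t ∈ Icc u v, |B n t ω| ≤ k} ≤ ε := by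
  obtain ⟨k₁, hk₁⟩ := exists_uniform_bound_of_gaussian
    (ι := {n // IsBrownianMotionOn (P n) (Icc u v) (B n)}) (P := fun n ↦ P n)
    (B := fun n ↦ B n) isCompact_Icc (fun n ↦ n.2.gaussian) (fun n ↦ n.2.mean)
    (fun n ↦ n.2.covariance) (fun n ↦ n.2.continuous) hε
  obtain ⟨k₂, hk₂⟩ := exists_uniform_bound_of_gaussian
    (ι := {n // IsBrownianBridgeOn (P n) (Icc u v) (B n)}) (P := fun n ↦ P n)
    (B := fun n ↦ B n) isCompact_Icc (fun n ↦ n.2.gaussian) (fun n ↦ n.2.mean)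
    (fun n ↦ n.2.covariance) (fun n ↦ n.2.continuous) hε
  refine ⟨max k₁ k₂, fun n ↦ ?_⟩
  rcases hB n with h | h
  · refine (measure_mono fun ω ↦ mt fun hle t ht ↦ ?_).trans (hk₁ ⟨n, h⟩)
    exact (hle t ht).trans (by exact_mod_cast le_max_left _ _)
  · refine (measure_mono fun ω ↦ mt fun hle t ht ↦ ?_).trans (hk₂ ⟨n, h⟩)
    exact (hle t ht).trans (by exact_mod_cast le_max_right _ _)

/-! ### Least concave majorants of perturbed concave functions -/

/-- A right-continuous function is the pointwise limit of the functions
`x ↦ g ((⌊x (k + 1)⌋ + 1) / (k + 1))`, which factor through the discrete space `ℤ`. -/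
theorem aemeasurable_of_rightContinuous {a b : ℝ} {g : ℝ → ℝ}
    (hg : ∀ t ∈ Ico a b, ContinuousWithinAt g (Ioi t) t) :
    AEMeasurable g (volume.restrict (Ioc a b)) := by
  rw [← restrict_Ico_eq_restrict_Ioc]
  have hmeas (k : ℕ) : Measurable fun x : ℝ ↦ g ((⌊x * (k + 1)⌋ + 1) / (k + 1)) :=
    (Measurable.of_discrete (f := fun z : ℤ ↦ g ((z + 1) / (k + 1)))).comp
      (Int.measurable_floor.comp (measurable_id.mul_const _))
  refine aemeasurable_of_tendsto_metrizable_ae atTop (fun k ↦ (hmeas k).aemeasurable) ?_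
  filter_upwards [ae_restrict_mem measurableSet_Ico] with x hx
  refine (hg x hx).tendsto.comp (tendsto_nhdsWithin_iff.2 ⟨?_, Eventually.of_forall fun k ↦ ?_⟩)
  · have h₁ : Tendsto (fun k : ℕ ↦ x + 1 / ((k : ℝ) + 1)) atTop (𝓝 x) := by
      simpa using tendsto_const_nhds.add (tendsto_one_div_add_atTop_nhds_zero_nat (𝕜 := ℝ))
    refine tendsto_of_tendsto_of_tendsto_of_le_of_le tendsto_const_nhds h₁ (fun k ↦ ?_)
      (fun k ↦ ?_)
    · have hk : (0 : ℝ) < k + 1 := by positivity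
      simp only [le_div_iff₀ hk]
      exact (Int.lt_floor_add_one _).le
    · have hk : (0 : ℝ) < k + 1 := by positivity
      simp only
      rw [div_le_iff₀ hk, add_mul, one_div, inv_mul_cancel₀ hk.ne']
      gcongr
      exact Int.floor_le _
  · have hk : (0 : ℝ) < k + 1 := by positivity
    rw [mem_Ioi, lt_div_iff₀ hk]
    exact Int.lt_floor_add_one _

/-- An affine function that lies above `g` on `s` and exceeds it by `E` at `x` bounds the least
concave majorant at `x`. The existence of one majorant also makes the infimum in
`leastConcaveMajorant` one over a nonempty set bounded below, hence a genuine one. -/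
theorem leastConcaveMajorant_sub_mem_Icc {s : Set ℝ} (hs : Convex ℝ s) {g : ℝ → ℝ} {x c E : ℝ}
    (hx : x ∈ s) (hg : ∀ z ∈ s, g z ≤ g x + c * (z - x) + E) :
    leastConcaveMajorant s g x - g x ∈ Icc 0 E := by
  let A : Set ℝ := {y : ℝ | ∃ h : ℝ → ℝ, ConcaveOn ℝ s h ∧ (∀ z ∈ s, g z ≤ h z) ∧ h x = y}
  have hmem : g x + E ∈ A := by
    refine ⟨fun z ↦ c * z + (g x - c * x + E), ?_, fun z hz ↦ (hg z hz).trans_eq (by ring), by ring⟩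
    exact ((LinearMap.mulLeft ℝ c).concaveOn hs).add_const _
  have hlb : g x ∈ lowerBounds A := by
    rintro _ ⟨h, -, hle, rfl⟩
    exact hle x hx
  have h₁ : g x ≤ leastConcaveMajorant s g x := le_csInf ⟨_, hmem⟩ hlb
  have h₂ : leastConcaveMajorant s g x ≤ g x + E := csInf_le ⟨_, hlb⟩ hmem
  exact ⟨by linarith, by linarith⟩

/-- If `φ` is within `κ + ρ` of a function `F` growing at rate at least `m`, then the line through
`(x, H x)` with slope `c - F x`, raised by `κ² / (2m) + ρ (b - a)`, majorizes the primitive `H` of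
`c - φ`. At distance `d` from `x`, the growth of `F` pulls `H` at least `m d² / 2` below the line,
while the error pushes it up by at most `κ d + ρ d`. Bounding `κ d - m d² / 2` by its maximum over
`d`, and not just `d` by `b - a`, is what makes the contribution of `κ` quadratic. -/
theorem integral_le_affine {a b m κ ρ c : ℝ} (hm : 0 < m) (hρ : 0 ≤ ρ)
    {F φ H : ℝ → ℝ} (hF : ∀ s ∈ Icc a b, ∀ t ∈ Icc a b, s ≤ t → m * (t - s) ≤ F t - F s)
    (hφ : IntervalIntegrable φ volume a b) (hφF : ∀ t ∈ Icc a b, |φ t - F t| ≤ κ + ρ)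
    (hH : ∀ t ∈ Icc a b, H t = ∫ x in a..t, (c - φ x))
    {x z : ℝ} (hx : x ∈ Icc a b) (hz : z ∈ Icc a b) :
    H z ≤ H x + (c - F x) * (z - x) + (κ ^ 2 / (2 * m) + ρ * (b - a)) := by
  have hab : a ≤ b := hx.1.trans hx.2
  have hint {s t : ℝ} (hs : s ∈ Icc a b) (ht : t ∈ Icc a b) :
      IntervalIntegrable (fun y ↦ c - φ y) volume s t :=
    (intervalIntegrable_const.sub hφ).mono_set
      (by rw [uIcc_of_le hab]; exact uIcc_subset_Icc hs ht)
  have ha : a ∈ Icc a b := left_mem_Icc.2 hab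
  have hdiff : H z - H x = ∫ y in x..z, (c - φ y) := by
    rw [hH z hz, hH x hx, intervalIntegral.integral_interval_sub_left (hint ha hz) (hint ha hx)]
  have hquad (d : ℝ) : κ * d - m * d ^ 2 / 2 ≤ κ ^ 2 / (2 * m) := by
    rw [le_div_iff₀ (by positivity)]
    nlinarith [sq_nonneg (κ - m * d)]
  have hlin (u α : ℝ) : ∫ y in x..z, (u + α * (y - x)) = u * (z - x) + α * (z - x) ^ 2 / 2 := by
    rw [intervalIntegral.integral_add (by simp) (by apply Continuous.intervalIntegrable; fun_prop)]
    rw [intervalIntegral.integral_const_mul, intervalIntegral.integral_sub (by simp) (by simp),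
      integral_id]
    simp
    ring
  rcases le_total x z with hxz | hzx
  · have key : ∫ y in x..z, (c - φ y) ≤ ∫ y in x..z, (c - F x + κ + ρ + -m * (y - x)) := by
      refine intervalIntegral.integral_mono_on hxz (hint hx hz)
        (by apply Continuous.intervalIntegrable; fun_prop) fun y hy ↦ ?_
      have hy' : y ∈ Icc a b := ⟨hx.1.trans hy.1, hy.2.trans hz.2⟩
      linarith [hF x hx y hy' hy.1, (abs_le.1 (hφF y hy')).1]
    rw [hlin] at key
    have : ρ * (z - x) ≤ ρ * (b - a) := by gcongr <;> [exact hz.2; exact hx.1]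
    linarith [hquad (z - x)]
  · have key : ∫ y in z..x, (c - F x - κ - ρ + -m * (y - x)) ≤ ∫ y in z..x, (c - φ y) := by
      refine intervalIntegral.integral_mono_on hzx
        (by apply Continuous.intervalIntegrable; fun_prop) (hint hz hx) fun y hy ↦ ?_
      have hy' : y ∈ Icc a b := ⟨hz.1.trans hy.1, hy.2.trans hx.2⟩
      linarith [hF y hy' x hx hy.2, (abs_le.1 (hφF y hy')).2]
    rw [intervalIntegral.integral_symm, hlin] at key
    rw [intervalIntegral.integral_symm] at hdiff
    have : ρ * (x - z) ≤ ρ * (b - a) := by gcongr <;> [exact hx.2; exact hz.1]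
    linarith [hquad (x - z)]

/-- The deterministic form of the theorem: an error `κ` in `φ` costs only order `κ²`, an error `ρ`
costs order `ρ`. -/
theorem abs_leastConcaveMajorant_sub_le {a b m κ ρ : ℝ} (hm : 0 < m) (hρ : 0 ≤ ρ)
    {F φ H : ℝ → ℝ} (hF : ∀ s ∈ Icc a b, ∀ t ∈ Icc a b, s ≤ t → m * (t - s) ≤ F t - F s)
    (hφ : IsCadlagOn a b φ) (hφF : ∀ t ∈ Icc a b, |φ t - F t| ≤ κ + ρ)
    (hH : ∀ t ∈ Icc a b, H t = ∫ x in a..t, (φ b - φ x)) {x : ℝ} (hx : x ∈ Icc a b) :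
    |leastConcaveMajorant (Icc a b) H x - H x| ≤ κ ^ 2 / (2 * m) + ρ * (b - a) := by
  have hab : a ≤ b := hx.1.trans hx.2
  have hmono {s t : ℝ} (hs : s ∈ Icc a b) (ht : t ∈ Icc a b) (hst : s ≤ t) : F s ≤ F t := by
    nlinarith [hF s hs t ht hst, mul_nonneg hm.le (sub_nonneg.2 hst)]
  -- Without integrability of `φ`, the integral defining `H` would be the junk value `0`.
  have hint : IntervalIntegrable φ volume a b := by
    rw [intervalIntegrable_iff_integrableOn_Ioc_of_le hab]
    refine Integrable.of_bound (aemeasurable_of_rightContinuous hφ.1).aestronglyMeasurable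
      (max |F a| |F b| + (κ + ρ)) ?_
    -- `F` is monotone on `[a, b]`, hence bounded by its values at the end points.
    filter_upwards [ae_restrict_mem measurableSet_Ioc] with t ht
    have ht' : t ∈ Icc a b := Ioc_subset_Icc_self ht
    have h₁ : |F t| ≤ max |F a| |F b| :=
      abs_le_max_abs_abs (hmono (left_mem_Icc.2 hab) ht' ht'.1)
        (hmono ht' (right_mem_Icc.2 hab) ht'.2)
    have h₂ : |φ t| ≤ |F t| + |φ t - F t| := by simpa using abs_add_le (F t) (φ t - F t)
    rw [Real.norm_eq_abs]
    linarith [hφF t ht']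
  have h := leastConcaveMajorant_sub_mem_Icc (convex_Icc a b) hx
    fun z hz ↦ integral_le_affine hm hρ hF hint hφF hH hx hz
  rw [abs_of_nonneg h.1]
  exact h.2

theorem mul_sub_le_integral_sub {a b m : ℝ} {f F : ℝ → ℝ} (hf : ContinuousOn f (Icc a b))
    (hm : ∀ t ∈ Icc a b, m ≤ f t) (hF : ∀ t ∈ Icc a b, F t = ∫ x in a..t, f x) :
    ∀ s ∈ Icc a b, ∀ t ∈ Icc a b, s ≤ t → m * (t - s) ≤ F t - F s := by
  intro s hs t ht hst
  have ha : a ∈ Icc a b := left_mem_Icc.2 (hs.1.trans hs.2)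
  have hint {u v : ℝ} (hu : u ∈ Icc a b) (hv : v ∈ Icc a b) : IntervalIntegrable f volume u v :=
    (hf.mono (uIcc_subset_Icc hu hv)).intervalIntegrable
  rw [hF t ht, hF s hs, intervalIntegral.integral_interval_sub_left (hint ha ht) (hint ha hs)]
  calc m * (t - s) = ∫ _ in s..t, m := by simp [mul_comm]
    _ ≤ ∫ y in s..t, f y := intervalIntegral.integral_mono_on hst (by simp) (hint hs ht)
        fun y hy ↦ hm y ⟨hs.1.trans hy.1, hy.2.trans ht.2⟩

/-! ### The rate of convergence -/

theorem supNormOn_le_ofReal_iff {s : Set ℝ} {g : ℝ → ℝ} {r : ℝ} (hr : 0 ≤ r) :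
    supNormOn s g ≤ ENNReal.ofReal r ↔ ∀ t ∈ s, |g t| ≤ r := by
  simp [supNormOn, ENNReal.ofReal_le_ofReal_iff hr]

theorem corollary5
    {Ω : ℕ → Type*} [∀ n, MeasurableSpace (Ω n)]
    (P : ∀ n, Measure (Ω n)) [∀ n, IsProbabilityMeasure (P n)]
    (a b : ℝ) (hab : a < b)
    -- the function `f`: continuous on `[a, b]`, bounded and bounded away from zero
    (f : ℝ → ℝ) (hf : ContinuousOn f (Icc a b))
    (hf_bdd : ∃ m M : ℝ, 0 < m ∧ ∀ t ∈ Icc a b, m ≤ f t ∧ f t ≤ M)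
    (F : ℝ → ℝ) (hF : ∀ t ∈ Icc a b, F t = ∫ x in a..t, f x)
    -- the cadlag estimators of `F`
    (Fn : ∀ n, ℝ → Ω n → ℝ)
    (hFn_meas : ∀ n, ∀ t ∈ Icc a b, AEMeasurable (Fn n t) (P n))
    (hFn_cadlag : ∀ n, ∀ᵐ ω ∂(P n), IsCadlagOn a b (fun t ↦ Fn n t ω))
    -- the time change `L`
    (L : ℝ → ℝ) (hL_mono : MonotoneOn L (Icc a b))
    (hL_bdd : ∃ M : ℝ, ∀ t ∈ Icc a b, |L t| ≤ M)
    -- the approximating processes on `[L a, L b]`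
    (B : ∀ n, ℝ → Ω n → ℝ)
    (hB : ∀ n, IsBrownianMotionOn (P n) (Icc (L a) (L b)) (B n) ∨
      IsBrownianBridgeOn (P n) (Icc (L a) (L b)) (B n))
    -- the embedding, with `γ n = O(log n / n)`
    (γ : ℕ → ℝ) (hγ : γ =O[atTop] fun n : ℕ ↦ Real.log n / n)
    (hembed : IsBigOInProbability P
      (fun n ω ↦ supNormOn (Icc a b)
        (fun t ↦ Fn n t ω - F t - (n : ℝ) ^ (-(1 / 2) : ℝ) * B n (L t) ω)) γ)
    -- the integrated process
    (H : ∀ n, ℝ → Ω n → ℝ)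
    (hH : ∀ n, ∀ t ∈ Icc a b, ∀ ω, H n t ω = ∫ x in a..t, (Fn n b ω - Fn n x ω)) :
    IsBigOInProbability P
      (fun n ω ↦ supNormOn (Icc a b)
        (fun x ↦ leastConcaveMajorant (Icc a b) (fun t ↦ H n t ω) x - H n x ω))
      (fun n : ℕ ↦ Real.log n / n) := by
  obtain ⟨m, M, hm, hfm⟩ := hf_bdd
  have hFinc := mul_sub_le_integral_sub hf (fun t ht ↦ (hfm t ht).1) hF
  intro ε hε
  obtain ⟨C, hC, hCn⟩ := hembed (ε / 2) (half_pos hε)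
  obtain ⟨k, hk⟩ := exists_uniform_bound_of_brownian hB (ε := ENNReal.ofReal (ε / 2))
    (ENNReal.ofReal_pos.2 (half_pos hε))
  obtain ⟨c, hc, hγc⟩ := hγ.exists_pos
  rw [Asymptotics.isBigOWith_iff] at hγc
  have hba : 0 < b - a := sub_pos.2 hab
  refine ⟨(k : ℝ) ^ 2 / (2 * m) + C * c * (b - a), by positivity, ?_⟩
  -- `3 > e`, so that `log n ≥ 1` and `1 / n` is dominated by `log n / n`.
  filter_upwards [hCn, hγc, eventually_ge_atTop 3] with n hn hγn hn3
  have hn0 : (0 : ℝ) < n := by positivity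
  have hlog : 1 ≤ Real.log n := by
    rw [Real.le_log_iff_exp_le hn0]
    have : (3 : ℝ) ≤ n := by exact_mod_cast hn3
    linarith [Real.exp_one_lt_d9]
  rw [Real.norm_eq_abs, Real.norm_eq_abs] at hγn
  set r : ℝ := |Real.log n / n| with hr
  have hr' : 1 / (n : ℝ) ≤ r := by
    rw [hr, abs_of_nonneg (by positivity)]
    gcongr
  have hbound : (n ^ (-(1 / 2) : ℝ) * k) ^ 2 / (2 * m) + C * |γ n| * (b - a)
      ≤ (k ^ 2 / (2 * m) + C * c * (b - a)) * r := by
    have hsq : ((n : ℝ) ^ (-(1 / 2) : ℝ)) ^ 2 = 1 / n := by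
      rw [← Real.rpow_natCast, ← Real.rpow_mul hn0.le]
      norm_num [Real.rpow_neg_one]
    have h₁ : (n ^ (-(1 / 2) : ℝ) * k) ^ 2 / (2 * m) ≤ k ^ 2 / (2 * m) * r := by
      rw [mul_pow, hsq, mul_comm, mul_div_right_comm]
      gcongr
    have h₂ : C * |γ n| * (b - a) ≤ C * c * (b - a) * r := by
      calc C * |γ n| * (b - a) ≤ C * (c * r) * (b - a) := by gcongr
        _ = _ := by ring
    linarith
  calc P n _ ≤ P n ({ω | ENNReal.ofReal (C * |γ n|) < supNormOn (Icc a b)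
          (fun t ↦ Fn n t ω - F t - (n : ℝ) ^ (-(1 / 2) : ℝ) * B n (L t) ω)} ∪
          {ω | ¬ ∀ t ∈ Icc (L a) (L b), |B n t ω| ≤ k}) := ?_
    _ ≤ ENNReal.ofReal (ε / 2) + ENNReal.ofReal (ε / 2) :=
        (measure_union_le _ _).trans (add_le_add hn (hk n))
    _ = ENNReal.ofReal ε := by
        rw [← ENNReal.ofReal_add (half_pos hε).le (half_pos hε).le, add_halves]
  refine measure_mono_ae ?_
  filter_upwards [hFn_cadlag n] with ω hω
  refine not_imp_not.1 fun hgood ↦ ?_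
  obtain ⟨hR, hW⟩ : supNormOn (Icc a b)
        (fun t ↦ Fn n t ω - F t - (n : ℝ) ^ (-(1 / 2) : ℝ) * B n (L t) ω)
          ≤ ENNReal.ofReal (C * |γ n|) ∧ ∀ t ∈ Icc (L a) (L b), |B n t ω| ≤ k :=
    ⟨not_lt.1 fun h ↦ hgood (Or.inl h), not_not.1 fun h ↦ hgood (Or.inr h)⟩
  rw [supNormOn_le_ofReal_iff (by positivity)] at hR
  refine not_lt.2 ((supNormOn_le_ofReal_iff (by positivity)).2 fun x hx ↦ ?_)
  refine (abs_leastConcaveMajorant_sub_le hm (ρ := C * |γ n|) (κ := n ^ (-(1 / 2) : ℝ) * k)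
    (by positivity) hFinc hω (fun t ht ↦ ?_) (fun t ht ↦ hH n t ht ω) hx).trans hbound
  have hLt : L t ∈ Icc (L a) (L b) :=
    ⟨hL_mono (left_mem_Icc.2 hab.le) ht ht.1, hL_mono ht (right_mem_Icc.2 hab.le) ht.2⟩
  have h₁ : |(n : ℝ) ^ (-(1 / 2) : ℝ) * B n (L t) ω| ≤ n ^ (-(1 / 2) : ℝ) * k := by
    rw [abs_mul, abs_of_nonneg (by positivity)]
    gcongr
    exact hW _ hLt
  have h₂ := abs_add_le (Fn n t ω - F t - (n : ℝ) ^ (-(1 / 2) : ℝ) * B n (L t) ω)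
    ((n : ℝ) ^ (-(1 / 2) : ℝ) * B n (L t) ω)
  rw [sub_add_cancel] at h₂
  linarith [hR t ht]
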